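/- Let $m,n$ be positive integers, and write $M_k(\mathbb{C})$ for the $k\times k$ complex matrices and $M_k^+(\mathbb{C})$ for the positive semidefinite ones. For a linear map $\Phi:M_m(\mathbb{C})\to M_n(\mathbb{C})$ let $\Phi^\dagger:M_n(\mathbb{C})\to M_m(\mathbb{C})$ be its adjoint with respect to the Hilbert–Schmidt inner products $\langle A,B\rangle=\operatorname{tr}[A^*B]$. Call $\Phi$ a *Schwarz map* if $\Phi(K^*K)\ge\Phi(K)^*\Phi(K)$ for all $K\in M_m(\mathbb{C})$ (in the order given by positive semidefiniteness), and *semiunital* if $\Phi^\dagger(\mathbf 1)=\frac{n}{m}\mathbf 1$. **Theorem.** Let $s,t>0$ with $s+t\le 1$, and let $\Phi:M_m(\mathbb{C})\to M_n(\mathbb{C})$ be a semiunital Schwarz map. Then for all $X,Y\in M_n^+(\mathbb{C})$ and all $K\in M_m(\mathbb{C})$, $$\operatorname{tr}\bigl[\Phi(K)^*X^s\Phi(K)Y^t\bigr]\le\left(\frac nm\right)^{1-(s+t)}\operatorname{tr}\bigl[K^*\,\Phi^\dagger(X)^s\,K\,\Phi^\dagger(Y)^t\bigr].$$ -/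

import Mathlib

open scoped Matrix ComplexOrder MatrixOrder

noncomputable section

/-- The adjoint `Φ† : M_n(ℂ) → M_m(ℂ)` of a linear map `Φ : M_m(ℂ) → M_n(ℂ)` for the
Hilbert--Schmidt inner products `⟨A, B⟩ = tr[A* B]`. Its `(i, j)` entry is
`⟨E_ij, Φ†(Y)⟩ = ⟨Φ(E_ij), Y⟩`, with `E_ij` the matrix units; the defining property of the adjoint
and its uniqueness are `hsAdjoint_inner` and `eq_hsAdjoint`. -/
def hsAdjoint {m n : ℕ}
    (Φ : Matrix (Fin m) (Fin m) ℂ →ₗ[ℂ] Matrix (Fin n) (Fin n) ℂ) :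
    Matrix (Fin n) (Fin n) ℂ →ₗ[ℂ] Matrix (Fin m) (Fin m) ℂ where
  toFun Y := Matrix.of fun i j => ((Φ (Matrix.single i j 1))ᴴ * Y).trace
  map_add' Y Z := by
    ext i j
    simp [Matrix.mul_add]
  map_smul' c Y := by
    ext i j
    simp

/-- `⟨Φ†(Y), X⟩ = ⟨Y, Φ(X)⟩` for all `X` and `Y`. -/
theorem hsAdjoint_inner {m n : ℕ}
    (Φ : Matrix (Fin m) (Fin m) ℂ →ₗ[ℂ] Matrix (Fin n) (Fin n) ℂ)
    (Y : Matrix (Fin n) (Fin n) ℂ) (X : Matrix (Fin m) (Fin m) ℂ) :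
    ((hsAdjoint Φ Y)ᴴ * X).trace = (Yᴴ * Φ X).trace := by
  have key : ∀ i j, star (hsAdjoint Φ Y i j) = (Yᴴ * Φ (Matrix.single i j 1)).trace := by
    intro i j
    simp only [hsAdjoint, LinearMap.coe_mk, AddHom.coe_mk, Matrix.of_apply]
    rw [← Matrix.trace_conjTranspose, Matrix.conjTranspose_mul, Matrix.conjTranspose_conjTranspose]
  conv_rhs => rw [Matrix.matrix_eq_sum_single X]
  have h1 : ∀ i j, Φ (Matrix.single i j (X i j)) = X i j • Φ (Matrix.single i j 1) := by
    intro i j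
    rw [← map_smul, Matrix.smul_single, smul_eq_mul, mul_one]
  simp only [map_sum, h1, Matrix.mul_sum, Matrix.trace_sum, Matrix.mul_smul, Matrix.trace_smul,
    ← key, smul_eq_mul]
  simp only [Matrix.trace, Matrix.diag_apply, Matrix.mul_apply, Matrix.conjTranspose_apply]
  rw [Finset.sum_comm]
  exact Finset.sum_congr rfl fun i _ => Finset.sum_congr rfl fun j _ => mul_comm _ _

/-- The adjoint is the only linear map with that property. -/
theorem eq_hsAdjoint {m n : ℕ}
    (Φ : Matrix (Fin m) (Fin m) ℂ →ₗ[ℂ] Matrix (Fin n) (Fin n) ℂ)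
    (Ψ : Matrix (Fin n) (Fin n) ℂ →ₗ[ℂ] Matrix (Fin m) (Fin m) ℂ)
    (h : ∀ Y X, ((Ψ Y)ᴴ * X).trace = (Yᴴ * Φ X).trace) : Ψ = hsAdjoint Φ := by
  ext1 Y
  apply Matrix.conjTranspose_injective
  refine Matrix.ext_iff_trace_mul_right.mpr fun X => ?_
  rw [h, hsAdjoint_inner]

/-- A Schwarz map: a linear map with `Φ(K* K) ≥ Φ(K)* Φ(K)` for all `K`, where `A ≥ B` means that
`A - B` is positive semidefinite. -/
def IsSchwarzMap {m n : ℕ}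
    (Φ : Matrix (Fin m) (Fin m) ℂ →ₗ[ℂ] Matrix (Fin n) (Fin n) ℂ) : Prop :=
  ∀ K : Matrix (Fin m) (Fin m) ℂ, (Φ (Kᴴ * K) - (Φ K)ᴴ * Φ K).PosSemidef

/-- A semiunital map: `Φ†(1) = (n/m) 1`. -/
def IsSemiunital {m n : ℕ}
    (Φ : Matrix (Fin m) (Fin m) ℂ →ₗ[ℂ] Matrix (Fin n) (Fin n) ℂ) : Prop :=
  hsAdjoint Φ 1 = ((n : ℂ) / (m : ℂ)) • (1 : Matrix (Fin m) (Fin m) ℂ)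

end

open scoped Matrix ComplexOrder MatrixOrder

open Matrix

/-! Left multiplication by `X` and right multiplication by `Y` commute, so `K ↦ tr[K* X^s K Y^t]` is
a diagonal quadratic form in the entries of `K` relative to eigenbases of `X` and `Y`. It is a
weighted geometric mean of the forms `tr[K* X K]`, `tr[K* K Y]` and `tr[K* K]`. The Schwarz
inequality bounds each of these at `Φ K` by its counterpart at `K` for `Φ† X`, `Φ† Y` and `n/m`.
Such bounds pass to geometric means: they pass to parallel sums by the variational formula
(`sum_parallel_sum_le`), and `x ^ p` is an integral of parallel sums (`sum_rpow_mul_rpow_le`). -/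

/-- Weighted quadratic form of the parallel sum of two nonnegative numbers. -/
theorem parallel_sum_mul_norm_add_sq_le {a b : ℝ} (ha : 0 ≤ a) (hb : 0 ≤ b) (u v : ℂ) :
    a * b / (a + b) * ‖u + v‖ ^ 2 ≤ a * ‖u‖ ^ 2 + b * ‖v‖ ^ 2 := by
  rcases (add_nonneg ha hb).eq_or_lt with h | h
  · rw [← h, div_zero, zero_mul]; positivity
  have h1 : ‖u + v‖ ^ 2 ≤ (‖u‖ + ‖v‖) ^ 2 := by gcongr; exact norm_add_le u v
  calc a * b / (a + b) * ‖u + v‖ ^ 2 ≤ a * b / (a + b) * (‖u‖ + ‖v‖) ^ 2 := by gcongr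
    _ ≤ a * ‖u‖ ^ 2 + b * ‖v‖ ^ 2 := by
      rw [div_mul_eq_mul_div, div_le_iff₀ h]
      nlinarith [sq_nonneg (a * ‖u‖ - b * ‖v‖)]

/-- Equality in `parallel_sum_mul_norm_add_sq_le` is attained. -/
theorem exists_add_eq_parallel_sum {a b : ℝ} (ha : 0 ≤ a) (hb : 0 ≤ b) (x : ℂ) :
    ∃ u v : ℂ, u + v = x ∧ a * ‖u‖ ^ 2 + b * ‖v‖ ^ 2 = a * b / (a + b) * ‖x‖ ^ 2 := by
  rcases (add_nonneg ha hb).eq_or_lt with h | h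
  · have ha0 : a = 0 := by linarith
    have hb0 : b = 0 := by linarith
    exact ⟨x, 0, by simp, by simp [ha0, hb0]⟩
  · refine ⟨((b / (a + b) : ℝ) : ℂ) * x, ((a / (a + b) : ℝ) : ℂ) * x, ?_, ?_⟩
    · rw [← add_mul, ← Complex.ofReal_add, ← add_div, add_comm b a, div_self h.ne']
      simp
    · rw [norm_mul, norm_mul, Complex.norm_real, Complex.norm_real, Real.norm_eq_abs,
        Real.norm_eq_abs, abs_of_nonneg (by positivity), abs_of_nonneg (by positivity)]
      field_simp
      ring

/-- The transformer inequality for parallel sums of diagonal forms. -/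
theorem sum_parallel_sum_le {ι κ : Type*} [Fintype ι] [Fintype κ]
    (W : (ι → ℂ) →ₗ[ℂ] (κ → ℂ)) {a b : κ → ℝ} {a' b' : ι → ℝ}
    (ha : ∀ k, 0 ≤ a k) (hb : ∀ k, 0 ≤ b k) (ha' : ∀ i, 0 ≤ a' i) (hb' : ∀ i, 0 ≤ b' i)
    (hWa : ∀ x, ∑ k, a k * ‖W x k‖ ^ 2 ≤ ∑ i, a' i * ‖x i‖ ^ 2)
    (hWb : ∀ x, ∑ k, b k * ‖W x k‖ ^ 2 ≤ ∑ i, b' i * ‖x i‖ ^ 2) (x : ι → ℂ) :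
    ∑ k, a k * b k / (a k + b k) * ‖W x k‖ ^ 2 ≤
      ∑ i, a' i * b' i / (a' i + b' i) * ‖x i‖ ^ 2 := by
  -- The splitting is optimal for `a'`, `b'`. Its image under `W` need not be optimal, but any
  -- splitting bounds the parallel sum of `a`, `b` from above.
  choose u v huv he using fun i => exists_add_eq_parallel_sum (ha' i) (hb' i) (x i)
  have hx : W x = W u + W v := by rw [← map_add]; congr 1; ext i; exact (huv i).symm
  calc ∑ k, a k * b k / (a k + b k) * ‖W x k‖ ^ 2
      ≤ ∑ k, (a k * ‖W u k‖ ^ 2 + b k * ‖W v k‖ ^ 2) := by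
        refine Finset.sum_le_sum fun k _ => ?_
        rw [hx]
        exact parallel_sum_mul_norm_add_sq_le (ha k) (hb k) _ _
    _ ≤ ∑ i, (a' i * ‖u i‖ ^ 2 + b' i * ‖v i‖ ^ 2) := by
        rw [Finset.sum_add_distrib, Finset.sum_add_distrib]
        exact add_le_add (hWa u) (hWb v)
    _ = _ := Finset.sum_congr rfl fun i _ => he i

/-- The case `b = 0` survives because `a / 0 = 0` and `0 ^ (1 - p) = 0` for `p < 1`, so singular
matrices need no limiting argument. -/
theorem mul_div_rpow_eq {a b p : ℝ} (ha : 0 ≤ a) (hb : 0 ≤ b) (hp : p < 1) :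
    b * (a / b) ^ p = a ^ p * b ^ (1 - p) := by
  rcases hb.eq_or_lt with rfl | hb
  · rw [zero_mul, Real.zero_rpow (by linarith), mul_zero]
  · rw [Real.div_rpow ha hb.le, Real.rpow_sub hb, Real.rpow_one]
    ring

-- The perspective of the integrand for `x ^ p` is a nonnegative multiple of the parallel sum of `a`
-- and `t * b`.
open Real in
theorem mul_rpowIntegrand₀₁_div_eq {a b p t : ℝ} (ha : 0 ≤ a) (hb : 0 ≤ b)
    (hp : p ∈ Set.Ioo 0 1) (ht : 0 < t) :
    b * rpowIntegrand₀₁ p t (a / b) = t ^ (p - 1) / t * (a * (t * b) / (a + t * b)) := by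
  rw [rpowIntegrand₀₁_eq_pow_div hp ht.le (by positivity)]
  rcases hb.eq_or_lt with rfl | hb
  · simp
  · have : 0 < a + t * b := by positivity
    have : 0 < t + a / b := by positivity
    field_simp
    rw [add_comm]

-- The normalizing integral stays unevaluated: it is positive and cancels when two such sums are
-- compared.
open Real in
theorem integral_sum_mul_rpowIntegrand₀₁ {σ : Type*} [Fintype σ] {p : ℝ} (hp : p ∈ Set.Ioo 0 1)
    (c d w : σ → ℝ) (hc : ∀ k, 0 ≤ c k) (hd : ∀ k, 0 ≤ d k) :
    MeasureTheory.IntegrableOn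
      (fun t => ∑ k, d k * rpowIntegrand₀₁ p t (c k / d k) * w k) (Set.Ioi 0) ∧
    ∫ t in Set.Ioi 0, ∑ k, d k * rpowIntegrand₀₁ p t (c k / d k) * w k =
      (∑ k, c k ^ p * d k ^ (1 - p) * w k) * ∫ t in Set.Ioi 0, rpowIntegrand₀₁ p t 1 := by
  have hint : ∀ k, MeasureTheory.IntegrableOn
      (fun t => d k * rpowIntegrand₀₁ p t (c k / d k) * w k) (Set.Ioi 0) := fun k =>
    ((integrableOn_rpowIntegrand₀₁_Ioi hp (div_nonneg (hc k) (hd k))).const_mul _).mul_const _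
  refine ⟨MeasureTheory.integrable_finsetSum _ fun k _ => hint k, ?_⟩
  rw [MeasureTheory.integral_finsetSum _ fun k _ => hint k, Finset.sum_mul]
  refine Finset.sum_congr rfl fun k _ => ?_
  rw [MeasureTheory.integral_mul_const, MeasureTheory.integral_const_mul,
    integral_rpowIntegrand₀₁_eq_rpow_mul_const hp (div_nonneg (hc k) (hd k)),
    ← mul_div_rpow_eq (hc k) (hd k) hp.2]
  ring

open Real in
/-- The transformer inequality for weighted geometric means of diagonal forms. -/
theorem sum_rpow_mul_rpow_le {ι κ : Type*} [Fintype ι] [Fintype κ]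
    (W : (ι → ℂ) →ₗ[ℂ] (κ → ℂ)) {a b : κ → ℝ} {a' b' : ι → ℝ}
    (ha : ∀ k, 0 ≤ a k) (hb : ∀ k, 0 ≤ b k) (ha' : ∀ i, 0 ≤ a' i) (hb' : ∀ i, 0 ≤ b' i)
    (hWa : ∀ x, ∑ k, a k * ‖W x k‖ ^ 2 ≤ ∑ i, a' i * ‖x i‖ ^ 2)
    (hWb : ∀ x, ∑ k, b k * ‖W x k‖ ^ 2 ≤ ∑ i, b' i * ‖x i‖ ^ 2)
    {p : ℝ} (hp : p ∈ Set.Ioo 0 1) (x : ι → ℂ) :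
    ∑ k, a k ^ p * b k ^ (1 - p) * ‖W x k‖ ^ 2 ≤
      ∑ i, a' i ^ p * b' i ^ (1 - p) * ‖x i‖ ^ 2 := by
  obtain ⟨hi, he⟩ := integral_sum_mul_rpowIntegrand₀₁ hp a b (fun k => ‖W x k‖ ^ 2) ha hb
  obtain ⟨hi', he'⟩ := integral_sum_mul_rpowIntegrand₀₁ hp a' b' (fun i => ‖x i‖ ^ 2) ha' hb'
  refine le_of_mul_le_mul_right ?_ (integral_rpowIntegrand₀₁_one_pos hp)
  rw [← he, ← he']
  refine MeasureTheory.setIntegral_mono_on hi hi' measurableSet_Ioi fun t ht => ?_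
  have ht : 0 < t := ht
  have hpar := sum_parallel_sum_le W (b := fun k => t * b k) (b' := fun i => t * b' i) ha
    (fun k => mul_nonneg ht.le (hb k)) ha' (fun i => mul_nonneg ht.le (hb' i)) hWa
    (fun x => by simpa only [mul_assoc, ← Finset.mul_sum] using
      mul_le_mul_of_nonneg_left (hWb x) ht.le) x
  have hc : 0 ≤ t ^ (p - 1) / t := by positivity
  have := mul_le_mul_of_nonneg_left hpar hc
  simpa only [mul_rpowIntegrand₀₁_div_eq (ha _) (hb _) hp ht,
    mul_rpowIntegrand₀₁_div_eq (ha' _) (hb' _) hp ht, mul_assoc, ← Finset.mul_sum] using this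

/-- The transformer inequality for geometric means of two diagonal forms and a constant. -/
theorem sum_rpow_mul_rpow_mul_le_const {ι κ : Type*} [Fintype ι] [Fintype κ]
    (W : (ι → ℂ) →ₗ[ℂ] (κ → ℂ)) {a b : κ → ℝ} {a' b' : ι → ℝ} {c : ℝ}
    (ha : ∀ k, 0 ≤ a k) (hb : ∀ k, 0 ≤ b k) (ha' : ∀ i, 0 ≤ a' i) (hb' : ∀ i, 0 ≤ b' i)
    (hc : 0 ≤ c)
    (hWa : ∀ x, ∑ k, a k * ‖W x k‖ ^ 2 ≤ ∑ i, a' i * ‖x i‖ ^ 2)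
    (hWb : ∀ x, ∑ k, b k * ‖W x k‖ ^ 2 ≤ ∑ i, b' i * ‖x i‖ ^ 2)
    (hWc : ∀ x, ∑ k, ‖W x k‖ ^ 2 ≤ c * ∑ i, ‖x i‖ ^ 2)
    {s t : ℝ} (hs : 0 < s) (ht : 0 < t) (hst : s + t ≤ 1) (x : ι → ℂ) :
    ∑ k, a k ^ s * b k ^ t * ‖W x k‖ ^ 2 ≤
      c ^ (1 - (s + t)) * ∑ i, a' i ^ s * b' i ^ t * ‖x i‖ ^ 2 := by
  have hs1 : 0 < 1 - s := by linarith
  rcases hst.eq_or_lt with h | h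
  · have := sum_rpow_mul_rpow_le W ha hb ha' hb' hWa hWb ⟨hs, by linarith⟩ x
    rw [h, sub_self, Real.rpow_zero, one_mul]
    rwa [show 1 - s = t by linarith] at this
  -- A nested mean: `b ^ τ * c ^ (1 - τ)` first, then its mean with `a` of weight `s`. This `τ`
  -- gives `b` the exponent `τ * (1 - s) = t` and leaves `1 - (s + t)` for `c`; `τ < 1` requires `s
  -- + t < 1`.
  set τ := t / (1 - s) with hτ
  have hτ0 : 0 < τ := by positivity
  have hτ1 : τ < 1 := by rw [hτ, div_lt_one hs1]; linarith
  have hτs : τ * (1 - s) = t := div_mul_cancel₀ _ hs1.ne'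
  have h1 := sum_rpow_mul_rpow_le W hb (b := fun _ => 1) (fun _ => zero_le_one) hb'
    (b' := fun _ => c) (fun _ => hc) hWb
    (fun x => by simpa only [one_mul, ← Finset.mul_sum] using hWc x) ⟨hτ0, hτ1⟩
  have h2 := sum_rpow_mul_rpow_le W ha (fun k => by have := hb k; positivity) ha'
    (fun i => by have := hb' i; positivity) hWa h1 ⟨hs, by linarith⟩ x
  refine h2.trans_eq' (Finset.sum_congr rfl fun k _ => ?_) |>.trans_eq ?_
  · rw [Real.one_rpow, mul_one, ← Real.rpow_mul (hb k), hτs]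
  · rw [Finset.mul_sum]
    refine Finset.sum_congr rfl fun i _ => ?_
    rw [Real.mul_rpow (Real.rpow_nonneg (hb' i) _) (Real.rpow_nonneg hc _),
      ← Real.rpow_mul (hb' i), ← Real.rpow_mul hc, hτs,
      show (1 - τ) * (1 - s) = 1 - (s + t) by rw [sub_mul, hτs]; ring]
    ring

theorem trace_conjTranspose_mul_diagonal_mul_diagonal {ι κ : Type*} [Fintype ι] [Fintype κ]
    [DecidableEq ι] [DecidableEq κ] (M : Matrix ι κ ℂ) (d : ι → ℝ) (e : κ → ℝ) :
    (Mᴴ * diagonal (fun i => (d i : ℂ)) * M * diagonal (fun j => (e j : ℂ))).trace =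
      ((∑ k : ι × κ, d k.1 * e k.2 * ‖M k.1 k.2‖ ^ 2 : ℝ) : ℂ) := by
  rw [Fintype.sum_prod_type_right]
  simp only [trace, diag_apply, mul_diagonal, Complex.ofReal_sum]
  refine Finset.sum_congr rfl fun j _ => ?_
  rw [mul_apply, Finset.sum_mul]
  refine Finset.sum_congr rfl fun i _ => ?_
  rw [mul_diagonal, conjTranspose_apply]
  push_cast
  rw [← Complex.conj_mul']
  simp only [RCLike.star_def]
  ring

theorem Matrix.IsHermitian.trace_conjTranspose_mul_cfc_mul_cfc {ι κ : Type*} [Fintype ι]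
    [Fintype κ] [DecidableEq ι] [DecidableEq κ] {X : Matrix ι ι ℂ} {Y : Matrix κ κ ℂ}
    (hX : X.IsHermitian) (hY : Y.IsHermitian) (f g : ℝ → ℝ) (K : Matrix ι κ ℂ) :
    (Kᴴ * cfc f X * K * cfc g Y).trace =
      ((∑ k : ι × κ, f (hX.eigenvalues k.1) * g (hY.eigenvalues k.2) *
        ‖((hX.eigenvectorUnitary : Matrix ι ι ℂ)ᴴ * K *
          (hY.eigenvectorUnitary : Matrix κ κ ℂ)) k.1 k.2‖ ^ 2 : ℝ) : ℂ) := by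
  rw [← trace_conjTranspose_mul_diagonal_mul_diagonal _ (fun i => f (hX.eigenvalues i))
    (fun j => g (hY.eigenvalues j)), hX.cfc_eq, hY.cfc_eq, Matrix.IsHermitian.cfc,
    Matrix.IsHermitian.cfc, Unitary.conjStarAlgAut_apply, Unitary.conjStarAlgAut_apply]
  simp only [star_eq_conjTranspose, conjTranspose_mul, conjTranspose_conjTranspose,
    ← Matrix.mul_assoc]
  rw [trace_mul_comm _ (hY.eigenvectorUnitary : Matrix κ κ ℂ)ᴴ]
  simp only [← Matrix.mul_assoc]
  rfl

theorem Matrix.PosSemidef.trace_mul_nonneg {ι : Type*} [Fintype ι] {A B : Matrix ι ι ℂ}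
    (hA : A.PosSemidef) (hB : B.PosSemidef) : 0 ≤ (A * B).trace := by
  classical
  obtain ⟨C, rfl⟩ := CStarAlgebra.nonneg_iff_eq_star_mul_self.mp hA.nonneg
  rw [star_eq_conjTranspose, Matrix.mul_assoc, trace_mul_comm]
  exact (hB.mul_mul_conjTranspose_same C).trace_nonneg

variable {m n : ℕ} {Φ : Matrix (Fin m) (Fin m) ℂ →ₗ[ℂ] Matrix (Fin n) (Fin n) ℂ}

theorem IsSchwarzMap.posSemidef_map_conjTranspose_mul_self (hΦ : IsSchwarzMap Φ)
    (K : Matrix (Fin m) (Fin m) ℂ) : (Φ (Kᴴ * K)).PosSemidef := by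
  simpa using (hΦ K).add (posSemidef_conjTranspose_mul_self (Φ K))

/-- Polarization: `Φ (L* L)` is Hermitian for `L = K`, `1`, `K + 1` and `K + i`, and the cross terms
determine `Φ K*`. -/
theorem IsSchwarzMap.map_conjTranspose (hΦ : IsSchwarzMap Φ) (K : Matrix (Fin m) (Fin m) ℂ) :
    Φ Kᴴ = (Φ K)ᴴ := by
  have h := fun K => (hΦ.posSemidef_map_conjTranspose_mul_self K).isHermitian
  have hK := h K
  have h1 := h 1
  have hp := h (K + 1)
  have hq := h (K + Complex.I • 1)
  simp only [IsHermitian, conjTranspose_add, conjTranspose_smul, conjTranspose_one, mul_add,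
    add_mul, mul_one, one_mul, map_add, smul_mul_assoc, mul_smul_comm, map_smul, RCLike.star_def,
    Complex.conj_I, neg_smul, map_neg, conjTranspose_neg, neg_mul] at hK h1 hp hq
  rw [hK, h1] at hp hq
  ext i j
  have e1 := congrFun₂ hp i j
  have e2 := congrFun₂ hq i j
  simp only [Matrix.add_apply, Matrix.neg_apply, Matrix.smul_apply, smul_eq_mul] at e1 e2
  have e2' : Complex.I * ((Φ K)ᴴ i j - (Φ Kᴴ)ᴴ i j + Φ K i j - Φ Kᴴ i j) = 0 := by
    linear_combination e2
  have e3 := (mul_eq_zero.mp e2').resolve_left Complex.I_ne_zero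
  linear_combination (-e1 - e3) / 2

theorem trace_mul_map_eq (Φ : Matrix (Fin m) (Fin m) ℂ →ₗ[ℂ] Matrix (Fin n) (Fin n) ℂ)
    {X : Matrix (Fin n) (Fin n) ℂ} (hX : X.IsHermitian) (Z : Matrix (Fin m) (Fin m) ℂ) :
    (X * Φ Z).trace = ((hsAdjoint Φ X)ᴴ * Z).trace := by
  rw [hsAdjoint_inner, hX.eq]

theorem IsSchwarzMap.posSemidef_hsAdjoint (hΦ : IsSchwarzMap Φ) {X : Matrix (Fin n) (Fin n) ℂ}
    (hX : X.PosSemidef) : (hsAdjoint Φ X).PosSemidef := by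
  have hh : (hsAdjoint Φ X).IsHermitian := by
    ext i j
    simp only [hsAdjoint, conjTranspose_apply, LinearMap.coe_mk, AddHom.coe_mk, of_apply]
    rw [← trace_conjTranspose, conjTranspose_mul, conjTranspose_conjTranspose, hX.isHermitian.eq,
      trace_mul_comm, ← hΦ.map_conjTranspose, conjTranspose_single, star_one]
  refine posSemidef_iff_dotProduct_mulVec.mpr ⟨hh, fun v => ?_⟩
  -- With `v v* = C* C`, the number `⟨v, Φ†(X) v⟩` equals `tr[X Φ(C* C)]`, a trace of a product of
  -- positive matrices.
  obtain ⟨C, hC⟩ := CStarAlgebra.nonneg_iff_eq_star_mul_self.mp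
    (posSemidef_vecMulVec_self_star v).nonneg
  have h := hX.trace_mul_nonneg (hΦ.posSemidef_map_conjTranspose_mul_self C)
  rwa [trace_mul_map_eq Φ hX.isHermitian, hh.eq, ← star_eq_conjTranspose, ← hC, mul_vecMulVec,
    trace_vecMulVec, dotProduct_comm] at h

theorem IsSchwarzMap.trace_mul_map_conjTranspose_mul_map_le (hΦ : IsSchwarzMap Φ)
    {X : Matrix (Fin n) (Fin n) ℂ} (hX : X.PosSemidef) (K : Matrix (Fin m) (Fin m) ℂ) :
    (X * ((Φ K)ᴴ * Φ K)).trace ≤ (hsAdjoint Φ X * (Kᴴ * K)).trace := by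
  have h := hX.trace_mul_nonneg (hΦ K)
  rwa [Matrix.mul_sub, trace_sub, sub_nonneg, trace_mul_map_eq Φ hX.isHermitian,
    (hΦ.posSemidef_hsAdjoint hX).isHermitian.eq] at h

/-- The map `Φ` in the eigenbases of two pairs of Hermitian matrices. -/
def unitaryCoordMap (Φ : Matrix (Fin m) (Fin m) ℂ →ₗ[ℂ] Matrix (Fin n) (Fin n) ℂ)
    (U V : Matrix (Fin n) (Fin n) ℂ) (U' V' : Matrix (Fin m) (Fin m) ℂ) :
    (Fin m × Fin m → ℂ) →ₗ[ℂ] (Fin n × Fin n → ℂ) where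
  toFun x k := (Uᴴ * Φ (U' * of (fun i j => x (i, j)) * V'ᴴ) * V) k.1 k.2
  map_add' x y := by
    have : of (fun i j => (x + y) (i, j)) = of (fun i j => x (i, j)) + of fun i j => y (i, j) := rfl
    simp only [this, mul_add, add_mul, map_add]
    rfl
  map_smul' c x := by
    have : of (fun i j => (c • x) (i, j)) = c • of (fun i j => x (i, j)) := rfl
    simp only [this, mul_smul_comm, smul_mul_assoc, map_smul]
    rfl

theorem theorem3p2 (m n : ℕ) (hm : 0 < m) (hn : 0 < n) (s t : ℝ) (hs : 0 < s) (ht : 0 < t)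
    (hst : s + t ≤ 1)
    (Φ : Matrix (Fin m) (Fin m) ℂ →ₗ[ℂ] Matrix (Fin n) (Fin n) ℂ)
    (hΦ : IsSchwarzMap Φ) (hΦ' : IsSemiunital Φ)
    (X Y : Matrix (Fin n) (Fin n) ℂ) (hX : X.PosSemidef) (hY : Y.PosSemidef)
    (K : Matrix (Fin m) (Fin m) ℂ) :
    ((Φ K)ᴴ * X ^ s * Φ K * Y ^ t).trace ≤
      ((((n : ℝ) / (m : ℝ)) ^ (1 - (s + t)) : ℝ) : ℂ) *
        (Kᴴ * (hsAdjoint Φ X) ^ s * K * (hsAdjoint Φ Y) ^ t).trace := by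
  have hX' := hΦ.posSemidef_hsAdjoint hX
  have hY' := hΦ.posSemidef_hsAdjoint hY
  set X' := hsAdjoint Φ X with hXdef
  set Y' := hsAdjoint Φ Y with hYdef
  let U : Matrix (Fin n) (Fin n) ℂ := hX.isHermitian.eigenvectorUnitary
  let V : Matrix (Fin n) (Fin n) ℂ := hY.isHermitian.eigenvectorUnitary
  let U' : Matrix (Fin m) (Fin m) ℂ := hX'.isHermitian.eigenvectorUnitary
  let V' : Matrix (Fin m) (Fin m) ℂ := hY'.isHermitian.eigenvectorUnitary
  let W := unitaryCoordMap Φ U V U' V'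
  let coord : Matrix (Fin m) (Fin m) ℂ → Fin m × Fin m → ℂ := fun L k => (U'ᴴ * L * V') k.1 k.2
  have hU' : U' * U'ᴴ = 1 := Unitary.mul_star_self_of_mem hX'.isHermitian.eigenvectorUnitary.2
  have hU'' : U'ᴴ * U' = 1 := Unitary.star_mul_self_of_mem hX'.isHermitian.eigenvectorUnitary.2
  have hV' : V' * V'ᴴ = 1 := Unitary.mul_star_self_of_mem hY'.isHermitian.eigenvectorUnitary.2
  have hV'' : V'ᴴ * V' = 1 := Unitary.star_mul_self_of_mem hY'.isHermitian.eigenvectorUnitary.2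
  have hback : ∀ L, U' * of (fun i j => coord L (i, j)) * V'ᴴ = L := by
    intro L
    change U' * (U'ᴴ * L * V') * V'ᴴ = L
    rw [show U' * (U'ᴴ * L * V') * V'ᴴ = (U' * U'ᴴ) * L * (V' * V'ᴴ) by
      simp only [Matrix.mul_assoc], hU', hV', one_mul, mul_one]
  have hW : ∀ L k, W (coord L) k = (Uᴴ * Φ L * V) k.1 k.2 := by
    intro L k
    change (Uᴴ * Φ (U' * of (fun i j => coord L (i, j)) * V'ᴴ) * V) k.1 k.2 = _
    rw [hback]
  have hsurj : ∀ x, ∃ L, coord L = x := by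
    intro x
    refine ⟨U' * of (fun i j => x (i, j)) * V'ᴴ, ?_⟩
    funext k
    change (U'ᴴ * (U' * of (fun i j => x (i, j)) * V'ᴴ) * V') k.1 k.2 = _
    rw [show U'ᴴ * (U' * of (fun i j => x (i, j)) * V'ᴴ) * V' =
      (U'ᴴ * U') * of (fun i j => x (i, j)) * (V'ᴴ * V') by
      simp only [Matrix.mul_assoc], hU'', hV'', one_mul, mul_one]
    rfl
  have tr := fun f g L =>
    hX.isHermitian.trace_conjTranspose_mul_cfc_mul_cfc hY.isHermitian f g (Φ L)
  have tr' := fun f g L =>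
    hX'.isHermitian.trace_conjTranspose_mul_cfc_mul_cfc hY'.isHermitian f g L
  have id1 : ∀ {k : ℕ} (A : Matrix (Fin k) (Fin k) ℂ), A.IsHermitian → cfc (fun x : ℝ => x) A = A :=
    fun A hA => cfc_id' ℝ A hA
  have one1 : ∀ {k : ℕ} (A : Matrix (Fin k) (Fin k) ℂ), A.IsHermitian →
      cfc (fun _ : ℝ => (1 : ℝ)) A = 1 :=
    fun A hA => cfc_const_one ℝ A hA
  rw [CFC.rpow_eq_cfc_real hX.nonneg, CFC.rpow_eq_cfc_real hY.nonneg,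
    CFC.rpow_eq_cfc_real hX'.nonneg, CFC.rpow_eq_cfc_real hY'.nonneg, tr, tr',
    ← Complex.ofReal_mul, Complex.real_le_real]
  have main := sum_rpow_mul_rpow_mul_le_const W
    (a := fun k => hX.isHermitian.eigenvalues k.1) (b := fun k => hY.isHermitian.eigenvalues k.2)
    (a' := fun k => hX'.isHermitian.eigenvalues k.1)
    (b' := fun k => hY'.isHermitian.eigenvalues k.2) (c := (n : ℝ) / m)
    (fun k => hX.eigenvalues_nonneg _) (fun k => hY.eigenvalues_nonneg _)
    (fun k => hX'.eigenvalues_nonneg _) (fun k => hY'.eigenvalues_nonneg _) (by positivity)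
    ?_ ?_ ?_ hs ht hst (coord K)
  · simpa only [hW] using main
  · intro x
    obtain ⟨L, rfl⟩ := hsurj x
    have e := tr (fun x => x) (fun _ => 1) L
    have e' := tr' (fun x => x) (fun _ => 1) L
    rw [id1 _ hX.isHermitian, one1 _ hY.isHermitian] at e
    rw [id1 _ hX'.isHermitian, one1 _ hY'.isHermitian] at e'
    -- `X` acts on the left, and `tr[Φ(L)* X Φ(L)] = tr[X Φ(L) Φ(L)*]`, so the Schwarz inequality is
    -- needed at `L*`.
    have h := hΦ.trace_mul_map_conjTranspose_mul_map_le hX Lᴴ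
    rw [hΦ.map_conjTranspose, conjTranspose_conjTranspose, conjTranspose_conjTranspose,
      ← Matrix.mul_assoc, ← Matrix.mul_assoc, trace_mul_comm, trace_mul_comm (_ * L),
      ← Matrix.mul_assoc, ← Matrix.mul_assoc, ← mul_one (_ * Φ L), ← mul_one (_ * L), e, e',
      Complex.real_le_real] at h
    simpa only [hW, mul_one] using h
  · intro x
    obtain ⟨L, rfl⟩ := hsurj x
    have e := tr (fun _ => 1) (fun x => x) L
    have e' := tr' (fun _ => 1) (fun x => x) L
    rw [one1 _ hX.isHermitian, id1 _ hY.isHermitian, mul_one] at e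
    rw [one1 _ hX'.isHermitian, id1 _ hY'.isHermitian, mul_one] at e'
    have h := hΦ.trace_mul_map_conjTranspose_mul_map_le hY L
    rw [trace_mul_comm, trace_mul_comm (hsAdjoint Φ Y), e, e', Complex.real_le_real] at h
    simpa only [hW, one_mul] using h
  · intro x
    obtain ⟨L, rfl⟩ := hsurj x
    have e := tr (fun _ => 1) (fun _ => 1) L
    have e' := tr' (fun _ => 1) (fun _ => 1) L
    rw [one1 _ hX.isHermitian, one1 _ hY.isHermitian, mul_one, mul_one] at e
    rw [one1 _ hX'.isHermitian, one1 _ hY'.isHermitian, mul_one, mul_one] at e'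
    -- At the identity, semiunitality turns `Φ†(1)` into the constant `n/m`.
    have h := hΦ.trace_mul_map_conjTranspose_mul_map_le PosSemidef.one L
    rw [hΦ', one_mul, smul_mul_assoc, one_mul, trace_smul, smul_eq_mul, e, e',
      show ((n : ℂ) / (m : ℂ)) = (((n : ℝ) / m : ℝ) : ℂ) by push_cast; rfl,
      ← Complex.ofReal_mul, Complex.real_le_real] at h
    simpa only [hW, one_mul] using h
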